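/- Let $\ell_2$ be the Hilbert space of square-summable complex sequences $z=(z_j)_{j\ge 1}$, and let $$\ell_2\cap\mathbb{D}^{\mathbb{N}}=\{z\in\ell_2 : |z_j|<1 \text{ for all } j\},$$ which is an open subset of $\ell_2$. For $1\le p<\infty$, the Hardy space $H_p(\ell_2\cap\mathbb{D}^{\mathbb{N}})$ consists of all functions $f:\ell_2\cap\mathbb{D}^{\mathbb{N}}\to\mathbb{C}$ that are holomorphic (i.e. complex Fréchet differentiable at every point of $\ell_2\cap\mathbb{D}^{\mathbb{N}}$) and satisfy $$\|f\|_{H_p}=\sup_{n\ge 1}\ \sup_{0<r<1}\Big(\int_{\mathbb{T}^n}|f(rw_1,\dots,rw_n,0,0,\dots)|^p\,\mathrm{d}w_1\cdots\mathrm{d}w_n\Big)^{1/p}<\infty,$$ where $\mathbb{T}^n$ carries the normalised Lebesgue measure. Proposition. Let $1\le p<\infty$, and let $(f_n)_n$ be a sequence in $H_p(\ell_2\cap\mathbb{D}^{\mathbb{N}})$ that is bounded, i.e. $\sup_n\|f_n\|_{H_p}<\infty$. Then there exist a function $f\in H_p(\ell_2\cap\mathbb{D}^{\mathbb{N}})$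 and a subsequence $(f_{n_k})_k$ that converges to $f$ uniformly on every compact subset of $\ell_2\cap\mathbb{D}^{\mathbb{N}}$. -/

import Mathlib

open MeasureTheory Filter Set
open scoped ENNReal

namespace MontelHardy

/-- The complex Hilbert space `ℓ₂` of square-summable complex sequences. -/
abbrev Ell2 : Type := lp (fun _ : ℕ => ℂ) 2

/-- The set `ℓ₂ ∩ 𝔻^ℕ` of square-summable sequences all of whose coordinates lie in the open
unit disc. -/
def polydisc : Set Ell2 := {z | ∀ j : ℕ, ‖z j‖ < 1}

/-- The finitely supported sequence `(z₁, …, zₙ, 0, 0, …)` as an element of `ℓ₂`. -/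
noncomputable def finSeq {n : ℕ} (z : Fin n → ℂ) : Ell2 :=
  ∑ i : Fin n, lp.single 2 (i : ℕ) (z i)

theorem finSeq_apply {n : ℕ} (z : Fin n → ℂ) (j : ℕ) :
    finSeq z j = if h : j < n then z ⟨j, h⟩ else 0 := by
  have h1 : finSeq z j = ∑ i : Fin n, (lp.single 2 (i : ℕ) (z i) : Ell2) j := by
    exact map_sum (lp.evalCLM ℂ (fun _ : ℕ => ℂ) 2 j)
      (fun i : Fin n => (lp.single 2 (i : ℕ) (z i) : Ell2)) Finset.univ
  rw [h1]
  split_ifs with h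
  · rw [Finset.sum_eq_single ⟨j, h⟩]
    · exact lp.single_apply_self (E := fun _ : ℕ => ℂ) 2 j (z ⟨j, h⟩)
    · intro i _ hi
      exact lp.single_apply_ne (E := fun _ : ℕ => ℂ) 2 (i : ℕ) (z i)
        (fun hj => hi (Fin.ext hj.symm))
    · intro hn
      exact absurd (Finset.mem_univ _) hn
  · refine Finset.sum_eq_zero fun i _ => ?_
    exact lp.single_apply_ne (E := fun _ : ℕ => ℂ) 2 (i : ℕ) (z i)
      (fun hj => h (hj ▸ i.isLt))

/-- The normalised Lebesgue measure on the `n`-torus `𝕋ⁿ`, where `𝕋` is parametrised by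
`ℝ / ℤ` through `t ↦ exp (2 π i t)`: the product of `n` copies of the Haar probability measure. -/
noncomputable def torusMeasure (n : ℕ) : Measure (Fin n → UnitAddCircle) :=
  Measure.pi fun _ => AddCircle.haarAddCircle

/-- The `p`-th integral mean
`(∫_{𝕋ⁿ} |f (r w₁, …, r wₙ, 0, 0, …)|^p dw₁ ⋯ dwₙ)^{1/p}`, with values in `[0, ∞]`. -/
noncomputable def integralMean (p : ℝ) (f : Ell2 → ℂ) (n : ℕ) (r : ℝ) : ℝ≥0∞ :=
  (∫⁻ t : Fin n → UnitAddCircle,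
    ‖f (finSeq fun j => (r : ℂ) * (AddCircle.toCircle (t j) : ℂ))‖ₑ ^ p ∂torusMeasure n) ^ (1 / p)

/-- The Hardy norm of `f` (in `[0, ∞]`): the supremum of the integral means over `n ≥ 1` and
`0 < r < 1`. It depends only on the values of `f` on `ℓ₂ ∩ 𝔻^ℕ`. -/
noncomputable def hardyNorm (p : ℝ) (f : Ell2 → ℂ) : ℝ≥0∞ :=
  ⨆ (n : ℕ) (_ : 1 ≤ n) (r : ℝ) (_ : r ∈ Ioo (0 : ℝ) 1), integralMean p f n r

/-- `f` is holomorphic on `ℓ₂ ∩ 𝔻^ℕ`: it is complex Fréchet differentiable at every point of this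
(open) set. The values of `f` off this set play no role. -/
def IsHolomorphic (f : Ell2 → ℂ) : Prop :=
  ∀ z ∈ polydisc, DifferentiableAt ℂ f z

/-- Membership (of the restriction of `f` to `ℓ₂ ∩ 𝔻^ℕ`) in the Hardy space
`H_p(ℓ₂ ∩ 𝔻^ℕ)`. -/
def MemHardy (p : ℝ) (f : Ell2 → ℂ) : Prop :=
  IsHolomorphic f ∧ hardyNorm p f < ∞

end MontelHardy

/-!
# Montel's theorem for Hardy spaces on `ℓ₂ ∩ 𝔻^ℕ`

The heart of the matter is that a bound on the Hardy norms gives a *local uniform bound* on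
`ℓ₂ ∩ 𝔻^ℕ`. Since `1 ≤ p`, the mean of order `1` is at most the mean of order `p`, so it suffices
to work with `L¹` means. In one variable, Cauchy's formula for `w ↦ u w * (1 - conj z * w)`, together
with `|1 - conj z * w| = |w - z|` on the unit circle, yields the sharp estimate
`|u z| (1 - |z|²) ≤ ∫ |u|` (`enorm_mul_le_lintegral_circle`). Iterating it one coordinate at a time
gives `|F z| ∏ (1 - |z_j|²) ≤ ∫ |F|` on the `n`-dimensional torus
(`enorm_mul_prod_le_lintegral_torus`). The quadratic dependence on `|z_j|` is what makes the product
bounded below on `ℓ₂`: it is at least `exp (-c ‖z‖²)` as long as the coordinates stay away from the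
unit circle, uniformly in `n`. Letting `n → ∞` bounds `f z` itself (`norm_le_of_hardyNorm_le`).

The rest is Montel's theorem for a locally bounded sequence of holomorphic functions on an open
subset of a separable Banach space (`exists_subseq_tendstoUniformlyOn_isCompact`). Local boundedness
gives equicontinuity by the Schwarz lemma; a diagonal argument on a countable dense set produces a
pointwise convergent subsequence, and convergence is automatically uniform on compact sets. Since the
space need not be locally compact, there need not be locally uniform convergence, and holomorphy of
the limit is obtained differently: by the second order Schwarz lemma the remainders
`f n w - f n z - (f n)'(z) (w - z)` are `O(‖w - z‖²)` uniformly in `n`, whence the derivatives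
converge pointwise, to a continuous linear map by the Banach–Steinhaus theorem, and this map is the
derivative of the limit.

Finally, Fatou's lemma bounds the Hardy norm of the limit (`hardyNorm_le_of_tendsto`).
-/

/-! ### Montel's theorem in separable Banach spaces -/

section Montel

open Metric Topology

variable {E : Type*} [NormedAddCommGroup E] [NormedSpace ℂ E]

theorem norm_sub_le_of_norm_le_on_ball {f : E → ℂ} {c z : E} {R C : ℝ}
    (hd : DifferentiableOn ℂ f (ball c R)) (hC : ∀ w ∈ ball c R, ‖f w‖ ≤ C) (hz : z ∈ ball c R) :
    ‖f z - f c‖ ≤ 2 * C / R * ‖z - c‖ := by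
  have hR : 0 < R := nonempty_ball.mp ⟨_, hz⟩
  have hm : MapsTo f (ball c R) (closedBall (f c) (2 * C)) := fun w hw => by
    rw [mem_closedBall, dist_eq_norm]
    linarith [norm_sub_le (f w) (f c), hC w hw, hC c (mem_ball_self hR)]
  simpa [dist_eq_norm] using Complex.dist_le_div_mul_dist_of_mapsTo_ball hd hm hz

/-- The first order Taylor remainder of a bounded holomorphic function on a ball is quadratically
small, with a constant depending only on the bound and the radius. -/
theorem norm_sub_sub_fderiv_le_of_norm_le_on_ball {f : E → ℂ} {c z : E} {R C : ℝ}
    (hd : DifferentiableOn ℂ f (ball c R)) (hC : ∀ w ∈ ball c R, ‖f w‖ ≤ C) (hz : z ∈ ball c R) :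
    ‖f z - f c - fderiv ℂ f c (z - c)‖ ≤ 4 * C * (‖z - c‖ / R) ^ 2 := by
  have hR : 0 < R := nonempty_ball.mp ⟨_, hz⟩
  have hm : MapsTo f (ball c R) (closedBall (f c) (2 * C)) := fun w hw => by
    rw [mem_closedBall, dist_eq_norm]
    linarith [norm_sub_le (f w) (f c), hC w hw, hC c (mem_ball_self hR)]
  have hfd : ‖fderiv ℂ f c‖ ≤ 2 * C / R := Complex.norm_fderiv_le_div_of_mapsTo_ball hd hm hR
  have hda : DifferentiableAt ℂ f c := hd.differentiableAt (ball_mem_nhds c hR)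
  set F : E → ℂ := fun w => f w - fderiv ℂ f c (w - c) with hF
  have hFd : DifferentiableOn ℂ F (ball c R) := by
    refine hd.sub ?_
    exact ((fderiv ℂ f c).differentiable.comp (differentiable_id.sub_const c)).differentiableOn
  have hFsub : ∀ w, F w - F c = f w - f c - fderiv ℂ f c (w - c) := fun w => by
    simp only [hF, sub_self, map_zero]; ring
  have hFm : MapsTo F (ball c R) (closedBall (F c) (4 * C)) := fun w hw => by
    rw [mem_closedBall, dist_eq_norm, hFsub]
    have h1 : ‖fderiv ℂ f c (w - c)‖ ≤ 2 * C := by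
      have hw' : ‖w - c‖ ≤ R := by simpa [dist_eq_norm] using (mem_ball.mp hw).le
      calc ‖fderiv ℂ f c (w - c)‖ ≤ 2 * C / R * ‖w - c‖ :=
            (fderiv ℂ f c).le_of_opNorm_le hfd _
        _ ≤ 2 * C / R * R := by
            gcongr
            exact (norm_nonneg _).trans hfd
        _ = 2 * C := by field_simp
    have h2 := mem_closedBall.mp (hm hw)
    rw [dist_eq_norm] at h2
    linarith [norm_sub_le (f w - f c) (fderiv ℂ f c (w - c))]
  have ho : (F · - F c) =o[𝓝 c] (fun w => ‖w - c‖ ^ 1) := by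
    simp only [pow_one, hFsub]
    exact hda.hasFDerivAt.isLittleO.norm_right
  have := Complex.dist_le_mul_div_pow_of_mapsTo_ball_of_isLittleO hFd hFm ho hz
  rwa [dist_eq_norm, hFsub, dist_eq_norm] at this

omit [NormedSpace ℂ E] in
theorem exists_ball_norm_le {U : Set E} (hU : IsOpen U) {f : ℕ → E → ℂ}
    (hb : ∀ z ∈ U, ∃ C : ℝ, ∀ᶠ w in 𝓝 z, ∀ n, ‖f n w‖ ≤ C) {z : E} (hz : z ∈ U) :
    ∃ R > 0, ∃ C, ball z R ⊆ U ∧ ∀ n, ∀ w ∈ ball z R, ‖f n w‖ ≤ C := by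
  obtain ⟨C, hC⟩ := hb z hz
  obtain ⟨R, hR, h⟩ := Metric.eventually_nhds_iff_ball.mp (hC.and (hU.mem_nhds hz))
  exact ⟨R, hR, C, fun w hw => (h w hw).2, fun n w hw => (h w hw).1 n⟩

theorem equicontinuousAt_of_locally_bounded {U : Set E} (hU : IsOpen U) {f : ℕ → E → ℂ}
    (hd : ∀ n, DifferentiableOn ℂ (f n) U)
    (hb : ∀ z ∈ U, ∃ C : ℝ, ∀ᶠ w in 𝓝 z, ∀ n, ‖f n w‖ ≤ C) {z : E} (hz : z ∈ U) :
    EquicontinuousAt f z := by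
  obtain ⟨R, hR, C, hRU, hC⟩ := exists_ball_norm_le hU hb hz
  refine equicontinuousAt_of_continuity_modulus (fun w => 2 * C / R * ‖w - z‖) ?_ f ?_
  · have : Tendsto (fun w => 2 * C / R * ‖w - z‖) (𝓝 z) (𝓝 (2 * C / R * ‖z - z‖)) :=
      Continuous.tendsto (by fun_prop) z
    simpa using this
  · filter_upwards [ball_mem_nhds z hR] with w hw n
    rw [dist_comm, dist_eq_norm]
    exact norm_sub_le_of_norm_le_on_ball ((hd n).mono hRU) (hC n) hw

/-- The diagonal argument: by compactness of a countable product of discs, some subsequence converges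
on a countable dense subset of `U`, and equicontinuity carries this over to all of `U`. -/
theorem exists_subseq_forall_tendsto_of_equicontinuousAt {X : Type*} [PseudoMetricSpace X]
    [TopologicalSpace.SeparableSpace X] {U : Set X} {f : ℕ → X → ℂ}
    (he : ∀ z ∈ U, EquicontinuousAt f z) (hb : ∀ z ∈ U, ∃ C : ℝ, ∀ n, ‖f n z‖ ≤ C) :
    ∃ φ : ℕ → ℕ, StrictMono φ ∧ ∀ z ∈ U, ∃ a, Tendsto (fun k => f (φ k) z) atTop (𝓝 a) := by
  obtain ⟨s, hsU, hsc, hUs⟩ :=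
    (TopologicalSpace.IsSeparable.of_separableSpace U).exists_countable_dense_subset
  have := hsc.to_subtype
  choose! C hC using hb
  have hK : IsCompact (Set.pi univ fun z : s => closedBall (0 : ℂ) (C z)) :=
    isCompact_univ_pi fun z => isCompact_closedBall _ _
  obtain ⟨a, -, φ, hφ, ha⟩ := hK.tendsto_subseq (x := fun n (z : s) => f n z)
    fun n z _ => by simpa using hC z (hsU z.2) n
  refine ⟨φ, hφ, fun z hz => cauchySeq_tendsto_of_complete ?_⟩
  rw [tendsto_pi_nhds] at ha
  rw [Metric.cauchySeq_iff]
  intro ε hε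
  obtain ⟨δ, hδ, hδf⟩ := Metric.equicontinuousAt_iff.mp (he z hz) (ε / 3) (by positivity)
  obtain ⟨w, hws, hw⟩ := Metric.mem_closure_iff.mp (hUs hz) δ hδ
  obtain ⟨N, hN⟩ := Metric.cauchySeq_iff.mp (ha ⟨w, hws⟩).cauchySeq (ε / 3) (by positivity)
  refine ⟨N, fun m hm n hn => ?_⟩
  have h1 := hδf w (by rwa [dist_comm]) (φ m)
  have h2 := hδf w (by rwa [dist_comm]) (φ n)
  rw [dist_comm] at h2
  have h3 : dist (f (φ m) w) (f (φ n) w) < ε / 3 := hN m hm n hn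
  have h4 := dist_triangle4 (f (φ m) z) (f (φ m) w) (f (φ n) w) (f (φ n) z)
  linarith

theorem tendstoUniformlyOn_of_equicontinuousAt {X : Type*} [TopologicalSpace X] {K : Set X}
    (hK : IsCompact K) {f : ℕ → X → ℂ} {g : X → ℂ} (he : ∀ z ∈ K, EquicontinuousAt f z)
    (hg : ∀ z ∈ K, Tendsto (fun k => f k z) atTop (𝓝 (g z))) :
    TendstoUniformlyOn f g atTop K := by
  have := (EquicontinuousOn.tendsto_uniformOnFun_iff_pi' (𝔖 := {K}) (F := f)
    (by simpa using hK) (by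
      simp only [mem_singleton_iff, forall_eq]
      exact fun z hz => (he z hz).equicontinuousWithinAt K) atTop g).mpr (by
      rw [tendsto_pi_nhds]
      rintro ⟨z, hz⟩
      exact hg z (by simpa using hz))
  exact UniformOnFun.tendsto_iff_tendstoUniformlyOn.mp this K rfl

/-- A pointwise limit of a locally bounded sequence of holomorphic functions on an open subset of a
Banach space is holomorphic. -/
theorem differentiableOn_of_tendsto [CompleteSpace E] {U : Set E} (hU : IsOpen U)
    {f : ℕ → E → ℂ} {g : E → ℂ} (hd : ∀ n, DifferentiableOn ℂ (f n) U)
    (hb : ∀ z ∈ U, ∃ C : ℝ, ∀ᶠ w in 𝓝 z, ∀ n, ‖f n w‖ ≤ C)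
    (hg : ∀ z ∈ U, Tendsto (fun k => f k z) atTop (𝓝 (g z))) :
    DifferentiableOn ℂ g U := by
  intro z hz
  refine DifferentiableAt.differentiableWithinAt ?_
  obtain ⟨R, hR, C, hRU, hC⟩ := exists_ball_norm_le hU hb hz
  have hT : ∀ n, ∀ w ∈ ball z R,
      ‖f n w - f n z - fderiv ℂ (f n) z (w - z)‖ ≤ 4 * C * (‖w - z‖ / R) ^ 2 := fun n w hw =>
    norm_sub_sub_fderiv_le_of_norm_le_on_ball ((hd n).mono hRU) (hC n) hw
  -- The derivatives converge pointwise: they are uniformly approximated by difference quotients.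
  have hex : ∀ h : E, ∃ a, Tendsto (fun n => fderiv ℂ (f n) z h) atTop (𝓝 a) := by
    intro h
    refine cauchySeq_tendsto_of_complete (Metric.cauchySeq_iff.mpr fun ε hε => ?_)
    -- A step `t` small enough that the difference quotients are `ε / 3`-close to the derivatives.
    have hlim : Tendsto (fun t : ℝ => 4 * C * (‖h‖ / R) ^ 2 * t) (𝓝[>] 0) (𝓝 0) := by
      have : Tendsto (fun t : ℝ => 4 * C * (‖h‖ / R) ^ 2 * t) (𝓝 0)
        (𝓝 (4 * C * (‖h‖ / R) ^ 2 * 0)) := Continuous.tendsto (by fun_prop) 0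
      rw [mul_zero] at this
      exact this.mono_left nhdsWithin_le_nhds
    have hball : ∀ᶠ t : ℝ in 𝓝[>] 0, z + (t : ℂ) • h ∈ ball z R := by
      have : Tendsto (fun t : ℝ => z + (t : ℂ) • h) (𝓝 0) (𝓝 (z + ((0 : ℝ) : ℂ) • h)) :=
        Continuous.tendsto (by fun_prop) 0
      simp only [Complex.ofReal_zero, zero_smul, add_zero] at this
      exact (this.mono_left nhdsWithin_le_nhds).eventually (ball_mem_nhds z hR)
    obtain ⟨t, ht, htb, ht0⟩ := ((hlim.eventually (gt_mem_nhds (show 0 < ε / 3 by positivity))).and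
      (hball.and self_mem_nhdsWithin)).exists
    have ht0 : 0 < t := ht0
    have htz : (t : ℂ) ≠ 0 := by exact_mod_cast ht0.ne'
    set q : ℕ → ℂ := fun n => (t : ℂ)⁻¹ * (f n (z + (t : ℂ) • h) - f n z) with hq
    have hqd : ∀ n, dist (q n) (fderiv ℂ (f n) z h) < ε / 3 := by
      intro n
      have h1 := hT n _ htb
      rw [add_sub_cancel_left, map_smul, smul_eq_mul, norm_smul, Complex.norm_real,
        Real.norm_of_nonneg ht0.le] at h1
      have h2 : q n - fderiv ℂ (f n) z h = (t : ℂ)⁻¹ *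
          (f n (z + (t : ℂ) • h) - f n z - (t : ℂ) * fderiv ℂ (f n) z h) := by
        simp only [hq]; field_simp
      rw [dist_eq_norm, h2, norm_mul, norm_inv, Complex.norm_real, Real.norm_of_nonneg ht0.le]
      refine lt_of_le_of_lt ?_ ht
      calc t⁻¹ * _ ≤ t⁻¹ * (4 * C * (t * ‖h‖ / R) ^ 2) := by gcongr
        _ = 4 * C * (‖h‖ / R) ^ 2 * t := by field_simp
    have hqc : CauchySeq q :=
      (((hg _ (hRU htb)).sub (hg z hz)).const_mul ((t : ℂ)⁻¹)).cauchySeq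
    obtain ⟨N, hN⟩ := Metric.cauchySeq_iff.mp hqc (ε / 3) (by positivity)
    refine ⟨N, fun m hm n hn => ?_⟩
    have h4 := dist_triangle4 (fderiv ℂ (f m) z h) (q m) (q n) (fderiv ℂ (f n) z h)
    rw [dist_comm _ (q m)] at h4
    linarith [hqd m, hqd n, hN m hm n hn]
  choose L hL using hex
  let L' : E →L[ℂ] ℂ :=
    continuousLinearMapOfTendsto (fun n => fderiv ℂ (f n) z) (tendsto_pi_nhds.mpr hL)
  have hL' : ∀ h, L' h = L h := fun h => rfl
  have hgT : ∀ w ∈ ball z R, ‖g w - g z - L' (w - z)‖ ≤ 4 * C / R ^ 2 * ‖w - z‖ ^ 2 := by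
    intro w hw
    have h1 : Tendsto (fun n => ‖f n w - f n z - fderiv ℂ (f n) z (w - z)‖) atTop
        (𝓝 ‖g w - g z - L' (w - z)‖) :=
      (((hg w (hRU hw)).sub (hg z hz)).sub (hL (w - z))).norm
    refine (le_of_tendsto' h1 fun n => hT n w hw).trans_eq ?_
    rw [div_pow]; ring
  refine HasFDerivAt.differentiableAt (f' := L') (HasFDerivAt.of_isLittleO ?_)
  refine (Asymptotics.IsBigO.of_bound (4 * C / R ^ 2) ?_).trans_isLittleO
    (g := fun w => ‖w - z‖ ^ 2) ?_
  · filter_upwards [ball_mem_nhds z hR] with w hw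
    simpa using hgT w hw
  · have := (Asymptotics.isLittleO_pow_id (𝕜 := ℝ) one_lt_two).comp_tendsto
      (tendsto_norm_sub_self z)
    exact Asymptotics.IsLittleO.of_norm_right this

/-- **Montel's theorem** on open subsets of separable Banach spaces. -/
theorem exists_subseq_tendstoUniformlyOn_isCompact [CompleteSpace E]
    [TopologicalSpace.SeparableSpace E] {U : Set E} (hU : IsOpen U) {f : ℕ → E → ℂ}
    (hd : ∀ n, DifferentiableOn ℂ (f n) U)
    (hb : ∀ z ∈ U, ∃ C : ℝ, ∀ᶠ w in 𝓝 z, ∀ n, ‖f n w‖ ≤ C) :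
    ∃ g : E → ℂ, DifferentiableOn ℂ g U ∧ ∃ φ : ℕ → ℕ, StrictMono φ ∧
      ∀ K ⊆ U, IsCompact K → TendstoUniformlyOn (fun k => f (φ k)) g atTop K := by
  have he : ∀ z ∈ U, EquicontinuousAt f z := fun z hz =>
    equicontinuousAt_of_locally_bounded hU hd hb hz
  obtain ⟨φ, hφ, hlim⟩ := exists_subseq_forall_tendsto_of_equicontinuousAt he fun z hz =>
    let ⟨C, hC⟩ := hb z hz
    ⟨C, hC.self_of_nhds⟩
  choose! g hg using hlim
  refine ⟨g, differentiableOn_of_tendsto hU (fun k => hd (φ k)) (fun z hz => ?_) hg, φ, hφ,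
    fun K hKU hK => tendstoUniformlyOn_of_equicontinuousAt hK
      (fun z hz => (he z (hKU hz)).comp φ) fun z hz => hg z (hKU hz)⟩
  obtain ⟨C, hC⟩ := hb z hz
  exact ⟨C, hC.mono fun w hw k => hw (φ k)⟩

end Montel

/-! ### Point evaluations on the polydisc and means over the torus -/

namespace MontelHardy
open Topology ComplexConjugate

theorem norm_one_sub_conj_mul_eq {z w : ℂ} (hw : ‖w‖ = 1) : ‖1 - conj z * w‖ = ‖w - z‖ := by
  have h : conj w * w = 1 := by
    rw [mul_comm, Complex.mul_conj, Complex.normSq_eq_norm_sq, hw]; simp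
  have h2 : 1 - conj z * w = conj (w - z) * w := by
    rw [map_sub, sub_mul, h]
  rw [h2, norm_mul, hw, mul_one, Complex.norm_conj]

/-- The sharp bound for point evaluations on the Hardy space `H₁` of the disc. -/
theorem enorm_mul_le_lintegral_circle {u : ℂ → ℂ}
    (hu : ∀ w, ‖w‖ ≤ 1 → DifferentiableAt ℂ u w) {z : ℂ} (hz : ‖z‖ < 1) :
    ‖u z‖ₑ * ENNReal.ofReal (1 - ‖z‖ ^ 2) ≤
      ∫⁻ t : UnitAddCircle, ‖u (AddCircle.toCircle t : ℂ)‖ₑ ∂AddCircle.haarAddCircle := by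
  set h : ℂ → ℂ := fun w => u w * (1 - conj z * w) with hh
  have hd : DifferentiableOn ℂ h (Metric.closedBall 0 1) := fun w hw =>
    ((hu w (by simpa using hw)).mul (by fun_prop)).differentiableWithinAt
  have hc := (hd.diffContOnCl_ball subset_rfl).two_pi_i_inv_smul_circleIntegral_sub_inv_smul
    (w := z) (by simpa using hz)
  have hz' : ‖u z‖ₑ * ENNReal.ofReal (1 - ‖z‖ ^ 2) = ‖h z‖ₑ := by
    have h1 : (1 - conj z * z) = ((1 - ‖z‖ ^ 2 : ℝ) : ℂ) := by
      rw [mul_comm, Complex.mul_conj, Complex.normSq_eq_norm_sq]; push_cast; ring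
    rw [hh]
    simp only [h1, enorm_mul]
    congr 1
    rw [← ofReal_norm, Complex.norm_real, Real.norm_of_nonneg]
    nlinarith [norm_nonneg z]
  -- Cauchy's formula, with the circle parametrised by `s ↦ exp (2 π i s)` for `0 ≤ s ≤ 1`.
  have hI : h z = ∫ s in (0 : ℝ)..1, (Complex.I)⁻¹ • (deriv (circleMap 0 1) (2 * Real.pi * s) •
      ((circleMap 0 1 (2 * Real.pi * s) - z)⁻¹ • h (circleMap 0 1 (2 * Real.pi * s)))) := by
    rw [intervalIntegral.integral_comp_mul_left (fun θ => (Complex.I)⁻¹ •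
      (deriv (circleMap 0 1) θ • ((circleMap 0 1 θ - z)⁻¹ • h (circleMap 0 1 θ))))
      (by positivity), intervalIntegral.integral_smul, mul_zero, mul_one, ← hc, circleIntegral,
      ← Complex.coe_smul, smul_smul, mul_inv]
    push_cast
    rfl
  rw [hz', hI, intervalIntegral.integral_of_le zero_le_one]
  refine (enorm_integral_le_lintegral_enorm _).trans ?_
  have hvol : (AddCircle.haarAddCircle : Measure UnitAddCircle) = volume := by
    rw [AddCircle.volume_eq_smul_haarAddCircle]; simp
  rw [hvol, ← UnitAddCircle.lintegral_preimage 0, zero_add]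
  refine le_of_eq (lintegral_congr fun s => ?_)
  have hw : (AddCircle.toCircle (s : UnitAddCircle) : ℂ) = circleMap 0 1 (2 * Real.pi * s) := by
    simp [AddCircle.toCircle_apply_mk, circleMap, Circle.coe_exp]
  have hw1 : ‖circleMap 0 1 (2 * Real.pi * s)‖ = 1 := by simp
  rw [hw]
  set w := circleMap 0 1 (2 * Real.pi * s) with hwdef
  have hne : ‖w - z‖ ≠ 0 := by
    rw [norm_ne_zero_iff, sub_ne_zero]
    rintro h0
    rw [← h0, hw1] at hz
    exact lt_irrefl _ hz
  have : ‖Complex.I⁻¹ • (deriv (circleMap 0 1) (2 * Real.pi * s) • ((w - z)⁻¹ • h w))‖ = ‖u w‖ := by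
    simp only [norm_smul, norm_inv, Complex.norm_I, deriv_circleMap, norm_mul, ← hwdef, hw1, hh,
      norm_one_sub_conj_mul_eq hw1]
    field_simp
  rw [← ofReal_norm, this, ofReal_norm]

theorem continuous_comp_torus {n : ℕ} {F : (Fin n → ℂ) → ℂ}
    (hF : ∀ z, (∀ j, ‖z j‖ ≤ 1) → ContinuousAt F z) :
    Continuous fun t : Fin n → UnitAddCircle => F fun j => (AddCircle.toCircle (t j) : ℂ) := by
  refine continuous_iff_continuousAt.mpr fun t => ContinuousAt.comp
    (f := fun t : Fin n → UnitAddCircle => fun j => (AddCircle.toCircle (t j) : ℂ))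
    (hF _ fun j => (Circle.norm_coe _).le) (Continuous.continuousAt ?_)
  exact continuous_pi fun j => continuous_subtype_val.comp
    (AddCircle.continuous_toCircle.comp (continuous_apply j))

instance (n : ℕ) : IsProbabilityMeasure (torusMeasure n) := by
  unfold torusMeasure; infer_instance

theorem lintegral_torusMeasure_succ {n : ℕ} {G : (Fin (n + 1) → UnitAddCircle) → ℝ≥0∞}
    (hG : Continuous G) :
    ∫⁻ t, G t ∂torusMeasure (n + 1) =
      ∫⁻ s, ∫⁻ a, G (Fin.cons a s) ∂AddCircle.haarAddCircle ∂torusMeasure n := by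
  have hmp := (measurePreserving_piFinSuccAbove
    (fun _ : Fin (n + 1) => (AddCircle.haarAddCircle : Measure UnitAddCircle)) 0).symm
  rw [torusMeasure, ← hmp.lintegral_comp hG.measurable, lintegral_prod_symm']
  · simp only [MeasurableEquiv.piFinSuccAbove_symm_apply, Fin.insertNthEquiv_zero]
    rfl
  · exact hG.measurable.comp (MeasurableEquiv.measurable _)

/-- The bound for point evaluations on the polydisc, obtained by applying the one-variable bound in
each coordinate. -/
theorem enorm_mul_prod_le_lintegral_torus {n : ℕ} {F : (Fin n → ℂ) → ℂ}
    (hF : ∀ z, (∀ j, ‖z j‖ ≤ 1) → DifferentiableAt ℂ F z) {z : Fin n → ℂ} (hz : ∀ j, ‖z j‖ < 1) :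
    ‖F z‖ₑ * ∏ j, ENNReal.ofReal (1 - ‖z j‖ ^ 2) ≤
      ∫⁻ t : Fin n → UnitAddCircle, ‖F fun j => (AddCircle.toCircle (t j) : ℂ)‖ₑ
        ∂torusMeasure n := by
  induction n with
  | zero =>
    have : ∀ w, F w = F z := fun w => congrArg F (Subsingleton.elim _ _)
    simp [this]
  | succ n ih =>
    rw [lintegral_torusMeasure_succ
      (continuous_comp_torus fun w hw => (hF w hw).continuousAt).enorm]
    have hcons : ∀ (a : UnitAddCircle) (s : Fin n → UnitAddCircle),
        (fun j => (AddCircle.toCircle ((Fin.cons a s : Fin (n + 1) → UnitAddCircle) j) : ℂ)) =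
          Fin.cons (AddCircle.toCircle a : ℂ) fun j => (AddCircle.toCircle (s j) : ℂ) := by
      intro a s
      ext j
      refine Fin.cases ?_ (fun i => ?_) j <;> simp
    have hbound : ∀ (a : ℂ) (s : Fin n → ℂ), ‖a‖ ≤ 1 → (∀ j, ‖s j‖ ≤ 1) →
        ∀ j, ‖(Fin.cons a s : Fin (n + 1) → ℂ) j‖ ≤ 1 := by
      intro a s ha hs j
      refine Fin.cases ?_ (fun i => ?_) j
      · simpa using ha
      · simpa using hs i
    have h1 := ih (F := fun s => F (Fin.cons (z 0) s)) (z := Fin.tail z) (fun s hs =>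
      (hF _ (hbound _ _ (hz 0).le hs)).comp s (by
        refine differentiableAt_pi.mpr fun j => ?_
        refine Fin.cases (by simp) (fun i => ?_) j
        simp only [Fin.cons_succ]
        fun_prop)) fun j => hz j.succ
    simp only [Fin.cons_self_tail] at h1
    rw [Fin.prod_univ_succ, mul_comm (ENNReal.ofReal _), ← mul_assoc]
    refine (mul_le_mul_left h1 _).trans ?_
    rw [← lintegral_mul_const' _ _ ENNReal.ofReal_ne_top]
    refine lintegral_mono fun s => ?_
    simp only [hcons]
    refine enorm_mul_le_lintegral_circle
      (u := fun a => F (Fin.cons a fun j => (AddCircle.toCircle (s j) : ℂ))) (fun a ha =>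
      (hF _ (hbound _ _ ha fun j => (Circle.norm_coe _).le)).comp a (by
        refine differentiableAt_pi.mpr fun j => ?_
        refine Fin.cases ?_ (fun i => ?_) j <;> simp)) (hz 0)

/-! ### The domain `ℓ₂ ∩ 𝔻^ℕ` -/

theorem finSeq_mem_polydisc {n : ℕ} {z : Fin n → ℂ} (hz : ∀ j, ‖z j‖ < 1) :
    finSeq z ∈ polydisc := fun j => by
  rw [finSeq_apply]
  split_ifs
  · exact hz _
  · simp

theorem differentiable_finSeq (n : ℕ) : Differentiable ℂ (finSeq : (Fin n → ℂ) → Ell2) := by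
  refine Differentiable.fun_sum fun i _ => ?_
  exact (lp.singleContinuousLinearMap ℂ (fun _ : ℕ => ℂ) 2 (i : ℕ)).differentiable.comp
    (differentiable_apply i)

theorem tendsto_finSeq (z : Ell2) :
    Tendsto (fun n => finSeq fun j : Fin n => z j) atTop (𝓝 z) := by
  have h := (lp.hasSum_single ENNReal.ofNat_ne_top z).tendsto_sum_nat
  refine h.congr fun n => ?_
  rw [finSeq, Fin.sum_univ_eq_sum_range fun i => (lp.single 2 i (z i) : Ell2)]

instance : TopologicalSpace.SeparableSpace Ell2 := by
  have hs : TopologicalSpace.IsSeparable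
      (Submodule.span ℂ (range fun i : ℕ => (lp.single 2 i 1 : Ell2)) : Set Ell2) :=
    (countable_range _).isSeparable.span
  refine TopologicalSpace.isSeparable_univ_iff.mp (hs.closure.mono fun z _ => ?_)
  refine mem_closure_of_tendsto (tendsto_finSeq z) (Eventually.of_forall fun n => ?_)
  refine Submodule.sum_mem _ fun i _ => ?_
  have : (lp.single 2 (i : ℕ) (z i) : Ell2) = z i • (lp.single 2 (i : ℕ) 1 : Ell2) := by
    rw [← lp.single_smul]; simp
  rw [this]
  exact Submodule.smul_mem _ _ (Submodule.subset_span ⟨_, rfl⟩)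

/-- The coordinates of a point of `ℓ₂ ∩ 𝔻^ℕ` stay uniformly away from the unit circle, because they
tend to zero. -/
theorem exists_forall_norm_le {z : Ell2} (hz : z ∈ polydisc) :
    ∃ ρ, 0 < ρ ∧ ρ < 1 ∧ ∀ j, ‖z j‖ ≤ ρ := by
  have hlim : Tendsto (fun j => ‖z j‖ ^ 2) cofinite (𝓝 0) := by
    simpa using ((lp.hasSum_norm (by simp) z).summable.tendsto_cofinite_zero)
  have hfin : {j | ¬ ‖z j‖ ^ 2 < (1 / 2) ^ 2}.Finite :=
    hlim.eventually (gt_mem_nhds (by norm_num))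
  have h1 : ∀ᶠ ρ : ℝ in 𝓝[<] 1, ∀ j ∈ {j | ¬ ‖z j‖ ^ 2 < (1 / 2) ^ 2}, ‖z j‖ ≤ ρ :=
    (eventually_all_finite hfin).mpr fun j _ =>
      (eventually_ge_nhds (hz j)).filter_mono nhdsWithin_le_nhds
  have h2 : ∀ᶠ ρ : ℝ in 𝓝[<] 1, 1 / 2 < ρ :=
    (eventually_gt_nhds (by norm_num)).filter_mono nhdsWithin_le_nhds
  obtain ⟨ρ, ⟨hρ1, hρ2⟩, hρ3⟩ := ((h1.and h2).and self_mem_nhdsWithin).exists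
  refine ⟨ρ, by linarith, hρ3, fun j => ?_⟩
  by_cases hj : ‖z j‖ ^ 2 < (1 / 2) ^ 2
  · exact (lt_of_pow_lt_pow_left₀ 2 (by norm_num) hj).le.trans hρ2.le
  · exact hρ1 j hj

theorem norm_apply_le_add_norm_sub (z w : Ell2) (j : ℕ) : ‖w j‖ ≤ ‖z j‖ + ‖w - z‖ := by
  have h1 : ‖(w - z) j‖ ≤ ‖w - z‖ := lp.norm_apply_le_norm (by simp) _ j
  rw [lp.coeFn_sub, Pi.sub_apply] at h1
  linarith [norm_le_norm_add_norm_sub' (w j) (z j)]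

theorem isOpen_polydisc : IsOpen polydisc := by
  rw [Metric.isOpen_iff]
  intro z hz
  obtain ⟨ρ, -, hρ, h⟩ := exists_forall_norm_le hz
  refine ⟨1 - ρ, by linarith, fun w hw j => ?_⟩
  rw [Metric.mem_ball, dist_eq_norm] at hw
  linarith [norm_apply_le_add_norm_sub z w j, h j]

/-! ### Local boundedness of bounded sets in the Hardy space -/

theorem integralMean_le_hardyNorm {p : ℝ} {f : Ell2 → ℂ} {n : ℕ} (hn : 1 ≤ n) {r : ℝ}
    (hr : r ∈ Ioo (0 : ℝ) 1) : integralMean p f n r ≤ hardyNorm p f :=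
  le_iSup₂_of_le n hn (le_iSup₂_of_le r hr le_rfl)

theorem norm_smul_lt_one {r : ℝ} (hr : r ∈ Ioo (0 : ℝ) 1) {w : ℂ} (hw : ‖w‖ ≤ 1) :
    ‖(r : ℂ) * w‖ < 1 := by
  rw [norm_mul, Complex.norm_real, Real.norm_of_nonneg hr.1.le]
  nlinarith [hr.1, hr.2, norm_nonneg w]

theorem IsHolomorphic.differentiableAt_comp_finSeq {f : Ell2 → ℂ} (hf : IsHolomorphic f) {n : ℕ}
    {r : ℝ} (hr : r ∈ Ioo (0 : ℝ) 1) {w : Fin n → ℂ} (hw : ∀ j, ‖w j‖ ≤ 1) :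
    DifferentiableAt ℂ (fun w : Fin n → ℂ => f (finSeq fun j => (r : ℂ) * w j)) w := by
  refine (hf _ (finSeq_mem_polydisc fun j => norm_smul_lt_one hr (hw j))).comp
    (f := fun w : Fin n → ℂ => finSeq fun j => (r : ℂ) * w j) w ?_
  exact (differentiable_finSeq n _).comp (f := fun w : Fin n → ℂ => fun j => (r : ℂ) * w j) w
    (by fun_prop)

theorem IsHolomorphic.continuous_torus {f : Ell2 → ℂ} (hf : IsHolomorphic f) (n : ℕ) {r : ℝ}
    (hr : r ∈ Ioo (0 : ℝ) 1) :
    Continuous fun t : Fin n → UnitAddCircle =>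
      f (finSeq fun j => (r : ℂ) * (AddCircle.toCircle (t j) : ℂ)) :=
  continuous_comp_torus (F := fun w => f (finSeq fun j => (r : ℂ) * w j)) fun _ hz =>
    (hf.differentiableAt_comp_finSeq hr hz).continuousAt

theorem IsHolomorphic.lintegral_enorm_le_integralMean {p : ℝ} (hp : 1 ≤ p) {f : Ell2 → ℂ}
    (hf : IsHolomorphic f) (n : ℕ) {r : ℝ} (hr : r ∈ Ioo (0 : ℝ) 1) :
    ∫⁻ t : Fin n → UnitAddCircle,
      ‖f (finSeq fun j => (r : ℂ) * (AddCircle.toCircle (t j) : ℂ))‖ₑ ∂torusMeasure n ≤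
        integralMean p f n r := by
  have h := eLpNorm_le_eLpNorm_of_exponent_le (μ := torusMeasure n) (p := 1)
    (q := ENNReal.ofReal p) (by simpa using hp)
    (hf.continuous_torus n hr).aestronglyMeasurable
  rw [eLpNorm_one_eq_lintegral_enorm, eLpNorm_eq_lintegral_rpow_enorm_toReal (by simp; linarith)
    ENNReal.ofReal_ne_top, ENNReal.toReal_ofReal (by linarith)] at h
  exact h

theorem exp_neg_le_one_sub {x y : ℝ} (hy : y < 1) (hx : 0 ≤ x) (hxy : x ≤ y) :
    Real.exp (-(x / (1 - y))) ≤ 1 - x := by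
  have h1 : 0 < 1 - x := by linarith
  have h2 : (1 - x)⁻¹ ≤ Real.exp (x / (1 - x)) := by
    have := Real.add_one_le_exp (x / (1 - x))
    have h3 : x / (1 - x) + 1 = (1 - x)⁻¹ := by field_simp; ring
    linarith
  have h3 : x / (1 - x) ≤ x / (1 - y) := by gcongr
  rw [Real.exp_neg]
  refine inv_le_of_inv_le₀ h1 (h2.trans (Real.exp_le_exp.mpr h3))

/-- The bound on finitely supported points. It is uniform in the number `n` of coordinates, which is
what allows the passage to all of `ℓ₂ ∩ 𝔻^ℕ`. -/
theorem norm_finSeq_le {p : ℝ} (hp : 1 ≤ p) {f : Ell2 → ℂ} (hf : IsHolomorphic f) {M : NNReal}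
    (hM : hardyNorm p f ≤ M) {z : Ell2} {ρ r : ℝ} (hr : r ∈ Ioo (0 : ℝ) 1)
    (hρ0 : 0 ≤ ρ) (hρ : ρ < r) (hz : ∀ j, ‖z j‖ ≤ ρ) {n : ℕ} (hn : 1 ≤ n) :
    ‖f (finSeq fun j : Fin n => z j)‖ ≤ M * Real.exp (‖z‖ ^ 2 / (r ^ 2 - ρ ^ 2)) := by
  have hr0 := hr.1
  have hr0' : (r : ℂ) ≠ 0 := by exact_mod_cast hr0.ne'
  -- The dilation `u ↦ f (r u)` is holomorphic up to the boundary of the polydisc and takes the value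
  -- in question at `w = z / r`.
  set w : Fin n → ℂ := fun j => (r : ℂ)⁻¹ * z j with hw
  have hwn : ∀ j, ‖w j‖ = ‖z j‖ / r := fun j => by
    rw [hw]
    simp only [norm_mul, norm_inv, Complex.norm_real, Real.norm_of_nonneg hr0.le]
    ring
  have hw1 : ∀ j, ‖w j‖ ≤ ρ / r := fun j => by
    rw [hwn]
    gcongr
    exact hz j
  have hρr : ρ / r < 1 := (div_lt_one hr0).mpr hρ
  have h1 := (enorm_mul_prod_le_lintegral_torus
    (F := fun w : Fin n → ℂ => f (finSeq fun j => (r : ℂ) * w j)) (z := w)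
    (fun _ hu => hf.differentiableAt_comp_finSeq hr hu) fun j => (hw1 j).trans_lt hρr).trans
    ((hf.lintegral_enorm_le_integralMean hp n hr).trans ((integralMean_le_hardyNorm hn hr).trans hM))
  have hwz : (fun j => (r : ℂ) * w j) = fun j : Fin n => z j := by
    ext j; rw [hw]; field_simp
  have hpos : ∀ j, 0 ≤ 1 - ‖w j‖ ^ 2 := fun j => by
    nlinarith [norm_nonneg (w j), (hw1 j).trans_lt hρr]
  simp only [hwz] at h1
  rw [← ENNReal.ofReal_prod_of_nonneg fun j _ => hpos j, ← ofReal_norm,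
    ← ENNReal.ofReal_mul (norm_nonneg _), ← ENNReal.ofReal_coe_nnreal] at h1
  replace h1 := (ENNReal.ofReal_le_ofReal_iff M.2).mp h1
  have h2 : Real.exp (-(‖z‖ ^ 2 / (r ^ 2 - ρ ^ 2))) ≤ ∏ j, (1 - ‖w j‖ ^ 2) := by
    calc Real.exp (-(‖z‖ ^ 2 / (r ^ 2 - ρ ^ 2)))
        ≤ Real.exp (∑ j : Fin n, -(‖w j‖ ^ 2 / (1 - (ρ / r) ^ 2))) := by
          rw [Real.exp_le_exp, Finset.sum_neg_distrib, neg_le_neg_iff]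
          have h3 : ∑ j : Fin n, ‖z j‖ ^ 2 ≤ ‖z‖ ^ 2 := by
            rw [Fin.sum_univ_eq_sum_range fun j => ‖z j‖ ^ 2]
            simpa using lp.sum_rpow_le_norm_rpow (p := 2) (by simp) z (Finset.range n)
          have h4 : 0 < r ^ 2 - ρ ^ 2 := by nlinarith
          calc ∑ j : Fin n, ‖w j‖ ^ 2 / (1 - (ρ / r) ^ 2)
              = (∑ j : Fin n, ‖z j‖ ^ 2) / (r ^ 2 - ρ ^ 2) := by
                rw [Finset.sum_div]
                refine Finset.sum_congr rfl fun j _ => ?_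
                rw [hwn, show 1 - (ρ / r) ^ 2 = (r ^ 2 - ρ ^ 2) / r ^ 2 by field_simp]
                field_simp
            _ ≤ _ := by gcongr
      _ = ∏ j : Fin n, Real.exp (-(‖w j‖ ^ 2 / (1 - (ρ / r) ^ 2))) := Real.exp_sum _ _
      _ ≤ _ := by
          refine Finset.prod_le_prod (fun j _ => (Real.exp_pos _).le) fun j _ => ?_
          refine exp_neg_le_one_sub ?_ (by positivity) (by gcongr; exact hw1 j)
          have : 0 ≤ ρ / r := by positivity
          nlinarith
  have h3 := (mul_le_mul_of_nonneg_left h2 (norm_nonneg _)).trans h1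
  rw [Real.exp_neg, ← div_eq_mul_inv, div_le_iff₀ (Real.exp_pos _)] at h3
  exact h3

theorem norm_le_of_hardyNorm_le {p : ℝ} (hp : 1 ≤ p) {f : Ell2 → ℂ} (hf : IsHolomorphic f)
    {M : NNReal} (hM : hardyNorm p f ≤ M) {z : Ell2} {ρ r : ℝ} (hr : r ∈ Ioo (0 : ℝ) 1)
    (hρ0 : 0 ≤ ρ) (hρ : ρ < r) (hz : ∀ j, ‖z j‖ ≤ ρ) :
    ‖f z‖ ≤ M * Real.exp (‖z‖ ^ 2 / (r ^ 2 - ρ ^ 2)) := by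
  have hzp : z ∈ polydisc := fun j => ((hz j).trans_lt hρ).trans hr.2
  refine le_of_tendsto (((hf z hzp).continuousAt.tendsto.comp (tendsto_finSeq z)).norm) ?_
  filter_upwards [eventually_ge_atTop 1] with n hn
  exact norm_finSeq_le hp hf hM hr hρ0 hρ hz hn

theorem exists_eventually_norm_le {p : ℝ} (hp : 1 ≤ p) {f : ℕ → Ell2 → ℂ}
    (hf : ∀ n, IsHolomorphic (f n)) {M : NNReal} (hM : ∀ n, hardyNorm p (f n) ≤ M)
    {z : Ell2} (hz : z ∈ polydisc) : ∃ C : ℝ, ∀ᶠ w in 𝓝 z, ∀ n, ‖f n w‖ ≤ C := by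
  obtain ⟨ρ, hρ0, hρ1, hzρ⟩ := exists_forall_norm_le hz
  obtain ⟨σ, hρσ, hσ1⟩ := exists_between hρ1
  obtain ⟨r, hσr, hr1⟩ := exists_between hσ1
  refine ⟨M * Real.exp ((‖z‖ + (σ - ρ)) ^ 2 / (r ^ 2 - σ ^ 2)), ?_⟩
  filter_upwards [Metric.ball_mem_nhds z (sub_pos.mpr hρσ)] with w hw n
  rw [Metric.mem_ball, dist_eq_norm] at hw
  refine (norm_le_of_hardyNorm_le hp (hf n) (hM n) (r := r) (ρ := σ) ⟨by linarith, hr1⟩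
    (by linarith) hσr fun j => ?_).trans ?_
  · linarith [norm_apply_le_add_norm_sub z w j, hzρ j]
  · have h1 : 0 ≤ r ^ 2 - σ ^ 2 := by nlinarith
    have h2 : ‖w‖ ≤ ‖z‖ + (σ - ρ) := by linarith [norm_le_norm_add_norm_sub' w z]
    gcongr

/-! ### The limit function -/

/-- Lower semicontinuity of the Hardy norm under pointwise convergence, from Fatou's lemma. -/
theorem hardyNorm_le_of_tendsto {p : ℝ} (hp : 0 < p) {f : ℕ → Ell2 → ℂ} {g : Ell2 → ℂ}
    (hf : ∀ n, IsHolomorphic (f n)) {M : ℝ≥0∞} (hM : ∀ n, hardyNorm p (f n) ≤ M)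
    (hg : ∀ z ∈ polydisc, Tendsto (fun k => f k z) atTop (𝓝 (g z))) : hardyNorm p g ≤ M := by
  refine iSup₂_le fun n hn => iSup₂_le fun r hr => ?_
  rw [integralMean, one_div, ENNReal.rpow_inv_le_iff hp]
  have hbound : ∀ k, ∫⁻ t : Fin n → UnitAddCircle,
      ‖f k (finSeq fun j => (r : ℂ) * (AddCircle.toCircle (t j) : ℂ))‖ₑ ^ p ∂torusMeasure n
        ≤ M ^ p := fun k => by
    rw [← ENNReal.rpow_inv_le_iff hp, ← one_div]
    exact (integralMean_le_hardyNorm hn hr).trans (hM k)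
  have hlim : ∀ t : Fin n → UnitAddCircle,
      ‖g (finSeq fun j => (r : ℂ) * (AddCircle.toCircle (t j) : ℂ))‖ₑ ^ p = liminf (fun k =>
        ‖f k (finSeq fun j => (r : ℂ) * (AddCircle.toCircle (t j) : ℂ))‖ₑ ^ p) atTop := fun t => by
    refine (Tendsto.liminf_eq ?_).symm
    refine ((ENNReal.continuous_rpow_const (y := p)).tendsto _).comp (Tendsto.enorm (hg _ ?_))
    exact finSeq_mem_polydisc fun j => norm_smul_lt_one hr (Circle.norm_coe _).le
  simp only [hlim]
  refine (lintegral_liminf_le fun k => ?_).trans ?_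
  · exact ((ENNReal.continuous_rpow_const (y := p)).comp
      ((hf k).continuous_torus n hr).enorm).measurable
  · exact liminf_le_of_frequently_le' (Frequently.of_forall hbound)

end MontelHardy

theorem proposition2p2 (p : ℝ) (hp : 1 ≤ p) (f : ℕ → MontelHardy.Ell2 → ℂ)
    (hf : ∀ n, MontelHardy.MemHardy p (f n))
    (hbdd : ∃ M : NNReal, ∀ n, MontelHardy.hardyNorm p (f n) ≤ M) :
    ∃ g : MontelHardy.Ell2 → ℂ, MontelHardy.MemHardy p g ∧
      ∃ φ : ℕ → ℕ, StrictMono φ ∧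
        ∀ K : Set MontelHardy.Ell2, K ⊆ MontelHardy.polydisc → IsCompact K →
          TendstoUniformlyOn (fun k => f (φ k)) g atTop K := by
  obtain ⟨M, hM⟩ := hbdd
  obtain ⟨g, hg, φ, hφ, hlim⟩ := exists_subseq_tendstoUniformlyOn_isCompact
    MontelHardy.isOpen_polydisc (fun n z hz => ((hf n).1 z hz).differentiableWithinAt)
    fun z hz => MontelHardy.exists_eventually_norm_le hp (fun n => (hf n).1) hM hz
  refine ⟨g, ⟨fun z hz => hg.differentiableAt (MontelHardy.isOpen_polydisc.mem_nhds hz), ?_⟩,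
    φ, hφ, hlim⟩
  refine (MontelHardy.hardyNorm_le_of_tendsto (by linarith) (fun k => (hf (φ k)).1)
    (fun k => hM (φ k)) fun z hz => ?_).trans_lt ENNReal.coe_lt_top
  exact (hlim {z} (by simpa using hz) isCompact_singleton).tendsto_at rfl
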